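/- Let $n\ge 1$ and $\tau>0$. For a weight vector $w\in\mathbb{R}^n$ with $w_i>0$ for all $i$, let $\|y\|_{w,1}=\sum_{i=1}^n w_i|y_i|$ and $\mathcal{C}_{w,1}=\{y\in\mathbb{R}^n : \|y\|_{w,1}\le\tau\}$, and let $\mathcal{P}_w(v)=\arg\min_{y\in\mathcal{C}_{w,1}}\|y-v\|_2$ be the Euclidean projection onto this ball. For $x,d\in\mathbb{R}^n$ consider the curve $p(\alpha)=\mathcal{P}_w(x+\alpha d)$, $\alpha\in\mathbb{R}$. The number of segments of a piecewise linear curve $p$ is the least number $k$ such that $\mathbb{R}$ can be cut at $k-1$ points into $k$ closed intervals on each of which $p$ is affine (possibly constant) in $\alpha$. (a) For all positive weights $w$ (in particular $w=(1,\dots,1)$) and all $x,d\in\mathbb{R}^n$, the curve $p$ is piecewise linear with at most $4n-1$ segments. (b) There exist positive weights $w$ and $x,d\in\mathbb{R}^n$ for which $p$ is piecewise linear with exactly $4n-1$ segments. -/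

import Mathlib

open Set

/-- The weighted one-norm `∑ i, w i * |x i|` on `ℝⁿ`. -/
def weightedOneNorm {n : ℕ} (w : Fin n → ℝ) (x : EuclideanSpace ℝ (Fin n)) : ℝ :=
  ∑ i, w i * |x i|

/-- The weighted one-norm ball of radius `τ` centred at the origin. -/
def weightedOneNormBall {n : ℕ} (w : Fin n → ℝ) (τ : ℝ) : Set (EuclideanSpace ℝ (Fin n)) :=
  {x | weightedOneNorm w x ≤ τ}

/-- `p` is a point of `C` at minimal Euclidean distance from `v`. -/
def IsProjectionOnto {n : ℕ} (C : Set (EuclideanSpace ℝ (Fin n)))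
    (v p : EuclideanSpace ℝ (Fin n)) : Prop :=
  p ∈ C ∧ ∀ y ∈ C, ‖p - v‖ ≤ ‖y - v‖

/-- The Euclidean projection `argmin {‖y - v‖ | y ∈ C}` (a chosen minimiser if there is one; for
nonempty closed convex `C` there is exactly one). -/
noncomputable def orthProj {n : ℕ} (C : Set (EuclideanSpace ℝ (Fin n)))
    (v : EuclideanSpace ℝ (Fin n)) : EuclideanSpace ℝ (Fin n) :=
  Classical.epsilon (IsProjectionOnto C v)

/-- The projection trajectory `α ↦ P(x + α d)`, `α ∈ ℝ`, of a line onto a weighted one-norm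
ball. -/
noncomputable def projectedLine {n : ℕ} (w : Fin n → ℝ) (τ : ℝ)
    (x d : EuclideanSpace ℝ (Fin n)) (α : ℝ) : EuclideanSpace ℝ (Fin n) :=
  orthProj (weightedOneNormBall w τ) (x + α • d)

/-- `f` is linear (affine, possibly constant) on `I`. -/
def IsLinearOn {E : Type*} [AddCommGroup E] [Module ℝ E] (f : ℝ → E) (I : Set ℝ) : Prop :=
  ∃ a b : E, ∀ α ∈ I, f α = a + α • b

/-- The finite set `B` of parameters cuts `ℝ` into `B.card + 1` closed intervals, on each of which
`f` is linear: `f` is linear on every interval whose interior contains no point of `B`. -/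
def IsSegmentation {E : Type*} [AddCommGroup E] [Module ℝ E] (f : ℝ → E) (B : Finset ℝ) : Prop :=
  ∀ I : Set ℝ, I.OrdConnected → Disjoint (interior I) (B : Set ℝ) → IsLinearOn f I

/-- `f` is (continuous and) piecewise linear with finitely many segments. -/
def IsPiecewiseLinear {E : Type*} [AddCommGroup E] [Module ℝ E] (f : ℝ → E) : Prop :=
  ∃ B : Finset ℝ, IsSegmentation f B

/-- The number of segments of a piecewise linear `f`: the least number of intervals in a
segmentation. (Only meaningful together with `IsPiecewiseLinear f`.) -/
noncomputable def numSegments {E : Type*} [AddCommGroup E] [Module ℝ E] (f : ℝ → E) : ℕ :=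
  sInf {k | ∃ B : Finset ℝ, IsSegmentation f B ∧ B.card + 1 = k}

theorem isClosed_weightedOneNormBall {n : ℕ} (w : Fin n → ℝ) (τ : ℝ) :
    IsClosed (weightedOneNormBall w τ) := by
  unfold weightedOneNormBall weightedOneNorm
  exact isClosed_le (by fun_prop) continuous_const

theorem convex_weightedOneNormBall {n : ℕ} {w : Fin n → ℝ} (hw : ∀ i, 0 < w i) (τ : ℝ) :
    Convex ℝ (weightedOneNormBall w τ) := by
  intro x hx y hy a b ha hb hab
  have key : weightedOneNorm w (a • x + b • y)
      ≤ a * weightedOneNorm w x + b * weightedOneNorm w y := by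
    unfold weightedOneNorm
    rw [Finset.mul_sum, Finset.mul_sum, ← Finset.sum_add_distrib]
    refine Finset.sum_le_sum fun i _ => ?_
    have h : |a * x i + b * y i| ≤ a * |x i| + b * |y i| := by
      refine (abs_add_le _ _).trans_eq ?_
      rw [abs_mul, abs_mul, abs_of_nonneg ha, abs_of_nonneg hb]
    have h2 := mul_le_mul_of_nonneg_left h (hw i).le
    simp only [PiLp.add_apply, PiLp.smul_apply, smul_eq_mul]
    linarith
  have h1 : weightedOneNorm w x ≤ τ := hx
  have h2 : weightedOneNorm w y ≤ τ := hy
  show weightedOneNorm w (a • x + b • y) ≤ τ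
  have h3 : a * τ + b * τ = τ := by rw [← add_mul, hab, one_mul]
  linarith [mul_le_mul_of_nonneg_left h1 ha, mul_le_mul_of_nonneg_left h2 hb]

theorem existsUnique_isProjectionOnto {n : ℕ} {w : Fin n → ℝ} (hw : ∀ i, 0 < w i) {τ : ℝ}
    (hτ : 0 < τ) (v : EuclideanSpace ℝ (Fin n)) :
    ∃! p, IsProjectionOnto (weightedOneNormBall w τ) v p := by
  have hc := convex_weightedOneNormBall hw τ
  have h0 : (0 : EuclideanSpace ℝ (Fin n)) ∈ weightedOneNormBall w τ := by
    simp [weightedOneNormBall, weightedOneNorm, hτ.le]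
  have inf_iff : ∀ p ∈ weightedOneNormBall w τ, IsProjectionOnto (weightedOneNormBall w τ) v p ↔
      ‖v - p‖ = ⨅ y : weightedOneNormBall w τ, ‖v - y‖ := by
    intro p hp
    have bdd : BddBelow (range fun y : weightedOneNormBall w τ => ‖v - y‖) :=
      ⟨0, forall_mem_range.2 fun _ => norm_nonneg _⟩
    have : Nonempty (weightedOneNormBall w τ) := ⟨⟨0, h0⟩⟩
    constructor
    · rintro ⟨_, h⟩
      refine le_antisymm (le_ciInf fun y => ?_) (ciInf_le bdd ⟨p, hp⟩)
      rw [norm_sub_rev v p, norm_sub_rev v]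
      exact h y y.2
    · intro h
      refine ⟨hp, fun y hy => ?_⟩
      rw [norm_sub_rev p v, norm_sub_rev y v, h]
      exact ciInf_le bdd ⟨y, hy⟩
  obtain ⟨p, hp, hpi⟩ := exists_norm_eq_iInf_of_complete_convex ⟨0, h0⟩
    (isClosed_weightedOneNormBall w τ).isComplete hc v
  refine ⟨p, (inf_iff p hp).2 hpi, fun q hq => ?_⟩
  have e1 := (norm_eq_iInf_iff_real_inner_le_zero hc hp).1 hpi q hq.1
  have e2 := (norm_eq_iInf_iff_real_inner_le_zero hc hq.1).1 ((inf_iff q hq.1).1 hq) p hp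
  have e3 : inner ℝ (q - p) (q - p) ≤ (0 : ℝ) := by
    have : inner ℝ (q - p) (q - p) = inner ℝ (v - p) (q - p) + inner ℝ (v - q) (p - q) := by
      simp only [inner_sub_left, inner_sub_right]
      ring
    linarith
  rw [real_inner_self_eq_norm_sq] at e3
  have e4 : ‖q - p‖ = 0 := pow_eq_zero_iff two_ne_zero |>.1 (le_antisymm e3 (sq_nonneg _))
  exact sub_eq_zero.1 (norm_eq_zero.1 e4)

/-- For positive weights and radius, `orthProj` is the genuine projection onto the ball. -/
theorem orthProj_eq_iff {n : ℕ} {w : Fin n → ℝ} (hw : ∀ i, 0 < w i) {τ : ℝ} (hτ : 0 < τ)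
    (v p : EuclideanSpace ℝ (Fin n)) :
    orthProj (weightedOneNormBall w τ) v = p ↔
      IsProjectionOnto (weightedOneNormBall w τ) v p := by
  have h := existsUnique_isProjectionOnto hw hτ v
  have hs : IsProjectionOnto (weightedOneNormBall w τ) v (orthProj (weightedOneNormBall w τ) v) :=
    Classical.epsilon_spec h.exists
  exact ⟨fun e => e ▸ hs, fun hp => h.unique hs hp⟩

/-! The projection soft-thresholds coordinate `i` of `v` at level `λ w i`, where `λ` is the
multiplier of the norm constraint (`orthProj_apply`). Along a line, `λ` is a convex function of `α`
(`convexOn_threshold`), so for each sign `s` the slack `s * (x i + α * d i) - λ w i` is concave and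
the set where coordinate `i` is active with sign `s` is an interval. While `λ > 0` and the active
signs do not change, `λ` is affine, hence so is the curve (`isLinearOn_projectedLine_of_active`).

Upper bound: the `2 * n` intervals have at most `4 * n` endpoints. If the line misses the ball they
cover `ℝ`, so at least two of these ends are infinite and at most `4 * n - 2` breakpoints remain. If
it meets the ball, the interval `λ = 0` comes in addition. But the norm along the line has a
minimiser `c` at which some coordinate `i₀` vanishes (`exists_coord_zero_weightedOneNorm_le`), and
`c` links the two intervals of `i₀` into one. The count stays at `2 * n` intervals covering `ℝ`.

Lower bound: with `n = m + 1`, the extremal line has slacks, divided by the weights, equal to `± (2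
k + 1) (α + k) - λ`. The heavy coordinate `0` makes the ball thin around `α = 0`, while the other
weights are so small that `λ (-β) < β` for `0 < β ≤ 2 m + 1`. Hence each coordinate `k ≥ 1` leaves
the support and returns with opposite sign around `α = -k`. Far out on either side the steepest
coordinate `m` forces `λ` up and expels all others. With the entry into the ball and the exit from
it, this gives `4 m + 2` distinct breakpoints. -/

/-! ### Scalar soft thresholding -/

/-- Soft thresholding of `a` at level `c`. -/
def softThreshold (a c : ℝ) : ℝ := max (a - c) 0 - max (-a - c) 0

theorem abs_softThreshold {a c : ℝ} (hc : 0 ≤ c) : |softThreshold a c| = max (|a| - c) 0 := by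
  unfold softThreshold
  rcases abs_cases a with ⟨h, h'⟩ | ⟨h, h'⟩ <;> rw [h]
  · rw [max_eq_right (by linarith : -a - c ≤ 0), sub_zero, abs_of_nonneg (le_max_right _ _)]
  · rw [max_eq_right (by linarith : a - c ≤ 0), zero_sub, abs_neg,
      abs_of_nonneg (le_max_right _ _)]

theorem sub_softThreshold_mul_le {a c : ℝ} (hc : 0 ≤ c) (y : ℝ) :
    (a - softThreshold a c) * y ≤ c * |y| := by
  have h : |a - softThreshold a c| ≤ c := by
    unfold softThreshold
    rw [abs_le]
    rcases max_cases (a - c) 0 with ⟨h1, h2⟩ | ⟨h1, h2⟩ <;>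
      rcases max_cases (-a - c) 0 with ⟨h3, h4⟩ | ⟨h3, h4⟩ <;> rw [h1, h3] <;>
      constructor <;> linarith
  calc (a - softThreshold a c) * y ≤ |(a - softThreshold a c) * y| := le_abs_self _
    _ = |a - softThreshold a c| * |y| := abs_mul _ _
    _ ≤ c * |y| := mul_le_mul_of_nonneg_right h (abs_nonneg _)

theorem softThreshold_of_lt {a c : ℝ} (hc : 0 ≤ c) (h : c < a) : softThreshold a c = a - c := by
  unfold softThreshold
  rw [max_eq_left (by linarith), max_eq_right (by linarith), sub_zero]

theorem softThreshold_of_lt_neg {a c : ℝ} (hc : 0 ≤ c) (h : c < -a) :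
    softThreshold a c = a + c := by
  unfold softThreshold
  rw [max_eq_right (by linarith), max_eq_left (by linarith)]
  ring

theorem softThreshold_of_abs_le {a c : ℝ} (h : |a| ≤ c) : softThreshold a c = 0 := by
  have := abs_le.1 h
  unfold softThreshold
  rw [max_eq_right (by linarith), max_eq_right (by linarith), sub_zero]

theorem softThreshold_zero (a : ℝ) : softThreshold a 0 = a := by
  unfold softThreshold
  rw [sub_zero, sub_zero, max_zero_sub_max_neg_zero_eq_self]

theorem sub_softThreshold_mul_self {a c : ℝ} (hc : 0 ≤ c) :
    (a - softThreshold a c) * softThreshold a c = c * |softThreshold a c| := by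
  rcases lt_or_ge c a with h | h
  · rw [softThreshold_of_lt hc h, abs_of_pos (by linarith)]; ring
  · rcases lt_or_ge c (-a) with h' | h'
    · rw [softThreshold_of_lt_neg hc h', abs_of_neg (by linarith)]; ring
    · rw [softThreshold_of_abs_le (abs_le.2 ⟨by linarith, h⟩)]; simp

/-! ### The Lagrange multiplier and the projection formula -/

/-- The weighted one-norm of the soft thresholding of `v` at the levels `μ * w i`. -/
def softExcess {n : ℕ} (w : Fin n → ℝ) (v : EuclideanSpace ℝ (Fin n)) (μ : ℝ) : ℝ :=
  ∑ i, w i * max (|v i| - μ * w i) 0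

theorem softExcess_zero {n : ℕ} (w : Fin n → ℝ) (v : EuclideanSpace ℝ (Fin n)) :
    softExcess w v 0 = weightedOneNorm w v := by
  unfold softExcess weightedOneNorm
  simp

theorem exists_threshold {n : ℕ} {w : Fin n → ℝ} (hw : ∀ i, 0 < w i) {τ : ℝ} (hτ : 0 < τ)
    (v : EuclideanSpace ℝ (Fin n)) :
    ∃ μ, 0 ≤ μ ∧ softExcess w v μ ≤ τ ∧ (0 < μ → softExcess w v μ = τ) := by
  rcases le_or_gt (softExcess w v 0) τ with h | h
  · exact ⟨0, le_rfl, h, fun h => absurd h (lt_irrefl _)⟩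
  · set M := ∑ i, |v i| / w i with hM
    have hM0 : 0 ≤ M := Finset.sum_nonneg fun i _ => div_nonneg (abs_nonneg _) (hw i).le
    have hgM : softExcess w v M = 0 := by
      refine Finset.sum_eq_zero fun i _ => ?_
      have : |v i| / w i ≤ M :=
        Finset.single_le_sum (f := fun i => |v i| / w i)
          (fun i _ => div_nonneg (abs_nonneg _) (hw i).le) (Finset.mem_univ i)
      rw [div_le_iff₀ (hw i)] at this
      rw [max_eq_right (by linarith), mul_zero]
    have hc : ContinuousOn (softExcess w v) (Icc 0 M) := by
      unfold softExcess
      fun_prop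
    obtain ⟨μ, hμ, e⟩ := intermediate_value_Icc' hM0 hc ⟨by rw [hgM]; exact hτ.le, h.le⟩
    exact ⟨μ, hμ.1, e.le, fun _ => e⟩

/-- The Lagrange multiplier of the projection of `v` onto the weighted one-norm ball. -/
noncomputable def threshold {n : ℕ} (w : Fin n → ℝ) (τ : ℝ) (v : EuclideanSpace ℝ (Fin n)) : ℝ :=
  Classical.epsilon fun μ => 0 ≤ μ ∧ softExcess w v μ ≤ τ ∧ (0 < μ → softExcess w v μ = τ)

section

variable {n : ℕ} {w : Fin n → ℝ} (hw : ∀ i, 0 < w i) {τ : ℝ} (hτ : 0 < τ)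
  (v : EuclideanSpace ℝ (Fin n))

include hw hτ

theorem threshold_spec : 0 ≤ threshold w τ v ∧ softExcess w v (threshold w τ v) ≤ τ ∧
    (0 < threshold w τ v → softExcess w v (threshold w τ v) = τ) :=
  Classical.epsilon_spec (exists_threshold hw hτ v)

/-- `softExcess` is antitone in `μ`, strictly so while positive, so a positive multiplier, where it
equals `τ > 0`, cannot exceed a feasible `μ`. Thus the multiplier is the least feasible level. -/
theorem threshold_le {μ : ℝ} (hμ : 0 ≤ μ) (h : softExcess w v μ ≤ τ) : threshold w τ v ≤ μ := by
  by_contra! hlt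
  have e := (threshold_spec hw hτ v).2.2 (hμ.trans_lt hlt)
  have hle : ∀ i, w i * max (|v i| - threshold w τ v * w i) 0 ≤ w i * max (|v i| - μ * w i) 0 :=
    fun i => mul_le_mul_of_nonneg_left (max_le_max_right 0
      (sub_le_sub_left (mul_le_mul_of_nonneg_right hlt.le (hw i).le) _)) (hw i).le
  obtain ⟨i, hi⟩ : ∃ i, 0 < w i * max (|v i| - threshold w τ v * w i) 0 := by
    by_contra! hno
    have := Finset.sum_nonpos fun i (_ : i ∈ Finset.univ) => hno i
    change softExcess w v (threshold w τ v) ≤ 0 at this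
    linarith
  have hi' : 0 < |v i| - threshold w τ v * w i := by
    by_contra! hn
    rw [max_eq_right hn, mul_zero] at hi
    exact lt_irrefl _ hi
  have : softExcess w v (threshold w τ v) < softExcess w v μ := by
    refine Finset.sum_lt_sum (fun i _ => hle i) ⟨i, Finset.mem_univ i, ?_⟩
    refine mul_lt_mul_of_pos_left ?_ (hw i)
    rw [max_eq_left hi'.le]
    exact lt_max_of_lt_left (sub_lt_sub_left (mul_lt_mul_of_pos_right hlt (hw i)) _)
  linarith

theorem threshold_lt {μ : ℝ} (hμ : 0 < μ) (h : softExcess w v μ < τ) : threshold w τ v < μ := by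
  refine lt_of_le_of_ne (threshold_le hw hτ v hμ.le h.le) fun e => ?_
  have := (threshold_spec hw hτ v).2.2 (e ▸ hμ)
  rw [e] at this
  linarith

theorem threshold_eq_zero_iff : threshold w τ v = 0 ↔ weightedOneNorm w v ≤ τ := by
  have hs := threshold_spec hw hτ v
  rw [← softExcess_zero]
  refine ⟨fun e => e ▸ hs.2.1, fun h => le_antisymm (threshold_le hw hτ v le_rfl h) hs.1⟩

theorem orthProj_apply (i : Fin n) : orthProj (weightedOneNormBall w τ) v i =
    softThreshold (v i) (threshold w τ v * w i) := by
  obtain ⟨h0, h1, h2⟩ := threshold_spec hw hτ v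
  set μ := threshold w τ v
  have hc : ∀ i, 0 ≤ μ * w i := fun i => mul_nonneg h0 (hw i).le
  set p : EuclideanSpace ℝ (Fin n) := WithLp.toLp 2 fun i => softThreshold (v i) (μ * w i) with hp
  have hpi : ∀ i, p i = softThreshold (v i) (μ * w i) := fun i => rfl
  have hpn : weightedOneNorm w p = softExcess w v μ := by
    unfold weightedOneNorm softExcess
    exact Finset.sum_congr rfl fun i _ => by rw [hpi, abs_softThreshold (hc i)]
  have : orthProj (weightedOneNormBall w τ) v = p := by
    rw [orthProj_eq_iff hw hτ]
    refine ⟨hpn.trans_le h1, fun y hy => ?_⟩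
    have hy : weightedOneNorm w y ≤ τ := hy
    rw [EuclideanSpace.norm_eq, EuclideanSpace.norm_eq]
    refine Real.sqrt_le_sqrt ?_
    -- Coordinatewise, `p` minimises the Lagrangian: squared distance to `v` plus `2 μ` times the
    -- weighted norm.
    have key : ∀ i, ‖(p - v) i‖ ^ 2 ≤
        ‖(y - v) i‖ ^ 2 + 2 * (μ * (w i * |y i|) - μ * (w i * |p i|)) := by
      intro i
      have e1 := sub_softThreshold_mul_le (a := v i) (hc i) (y i)
      have e2 := sub_softThreshold_mul_self (a := v i) (hc i)
      rw [← hpi] at e1 e2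
      simp only [PiLp.sub_apply, Real.norm_eq_abs, sq_abs]
      nlinarith [sq_nonneg (y i - p i)]
    have := Finset.sum_le_sum fun i (_ : i ∈ Finset.univ) => key i
    rw [Finset.sum_add_distrib, ← Finset.mul_sum, Finset.sum_sub_distrib, ← Finset.mul_sum,
      ← Finset.mul_sum] at this
    change _ ≤ _ + 2 * (μ * weightedOneNorm w y - μ * weightedOneNorm w p) at this
    have : μ * weightedOneNorm w y ≤ μ * weightedOneNorm w p := by
      rcases h0.eq_or_lt with h | h
      · rw [← h]; simp
      · rw [hpn, h2 h]; exact mul_le_mul_of_nonneg_left hy h0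
    linarith
  rw [this]

end

/-! ### Convexity of the multiplier along a line -/

section

variable {n : ℕ} {w : Fin n → ℝ} (hw : ∀ i, 0 < w i) {τ : ℝ} (hτ : 0 < τ)
  (x d : EuclideanSpace ℝ (Fin n))

include hw hτ

theorem projectedLine_apply (α : ℝ) (i : Fin n) : projectedLine w τ x d α i =
    softThreshold (x i + α * d i) (threshold w τ (x + α • d) * w i) := by
  unfold projectedLine
  rw [orthProj_apply hw hτ]
  rfl

/-- The feasible pairs `(α, μ)` form a convex set, because `softExcess` is jointly convex in the
point and the level; by `threshold_le` the multiplier is the lower boundary of this set. -/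
theorem convexOn_threshold : ConvexOn ℝ univ fun α : ℝ => threshold w τ (x + α • d) := by
  refine ⟨convex_univ, fun α _ β _ a b ha hb hab => ?_⟩
  obtain ⟨h0, h1, -⟩ := threshold_spec hw hτ (x + α • d)
  obtain ⟨k0, k1, -⟩ := threshold_spec hw hτ (x + β • d)
  simp only [smul_eq_mul]
  set μ := threshold w τ (x + α • d)
  set ν := threshold w τ (x + β • d)
  refine threshold_le hw hτ _ (by positivity) ?_
  have : softExcess w (x + (a * α + b * β) • d) (a * μ + b * ν) ≤
      a * softExcess w (x + α • d) μ + b * softExcess w (x + β • d) ν := by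
    unfold softExcess
    rw [Finset.mul_sum, Finset.mul_sum, ← Finset.sum_add_distrib]
    refine Finset.sum_le_sum fun i _ => ?_
    simp only [PiLp.add_apply, PiLp.smul_apply, smul_eq_mul]
    have e : x i + (a * α + b * β) * d i = a * (x i + α * d i) + b * (x i + β * d i) := by
      linear_combination (-x i) * hab
    have h : |x i + (a * α + b * β) * d i| ≤ a * |x i + α * d i| + b * |x i + β * d i| := by
      rw [e]
      refine (abs_add_le _ _).trans_eq ?_
      rw [abs_mul, abs_mul, abs_of_nonneg ha, abs_of_nonneg hb]
    have h' : max (|x i + (a * α + b * β) * d i| - (a * μ + b * ν) * w i) 0 ≤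
        a * max (|x i + α * d i| - μ * w i) 0 + b * max (|x i + β * d i| - ν * w i) 0 := by
      refine max_le ?_ (by positivity)
      have e1 := mul_le_mul_of_nonneg_left (le_max_left (|x i + α * d i| - μ * w i) 0) ha
      have e2 := mul_le_mul_of_nonneg_left (le_max_left (|x i + β * d i| - ν * w i) 0) hb
      linarith
    have := mul_le_mul_of_nonneg_left h' (hw i).le
    linarith
  have e1 := mul_le_mul_of_nonneg_left h1 ha
  have e2 := mul_le_mul_of_nonneg_left k1 hb
  have e3 : a * τ + b * τ = τ := by rw [← add_mul, hab, one_mul]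
  linarith

theorem continuous_threshold : Continuous fun α : ℝ => threshold w τ (x + α • d) := by
  rw [← continuousOn_univ]
  exact (convexOn_threshold hw hτ x d).continuousOn isOpen_univ

theorem continuous_projectedLine : Continuous (projectedLine w τ x d) := by
  rw [← (PiLp.homeomorph 2 fun _ : Fin n => ℝ).comp_continuous_iff]
  refine continuous_pi fun i => ?_
  have hc := continuous_threshold hw hτ x d
  have e : (fun α => projectedLine w τ x d α i) = fun α : ℝ =>
      softThreshold (x i + α * d i) (threshold w τ (x + α • d) * w i) :=
    funext fun α => projectedLine_apply hw hτ x d α i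
  change Continuous fun α => projectedLine w τ x d α i
  rw [e]
  unfold softThreshold
  fun_prop

end

/-! ### Counting the endpoints of intervals that cover the line -/

/-- A convex subset of the line has at most two boundary points, and loses one for each end at which
it is unbounded. -/
theorem Set.OrdConnected.exists_frontier_subset {S : Set ℝ} (hS : S.OrdConnected) :
    ∃ F : Finset ℝ, frontier S ⊆ F ∧
      F.card + (open Classical in if BddAbove S then 0 else 1) +
        (open Classical in if BddBelow S then 0 else 1) ≤ 2 := by
  classical
  rcases S.eq_empty_or_nonempty with rfl | hne
  · exact ⟨∅, by simp, by simp⟩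
  refine ⟨(if BddAbove S then {sSup S} else ∅) ∪ (if BddBelow S then {sInf S} else ∅), ?_, ?_⟩
  · intro z hz
    by_contra hzF
    simp only [Finset.coe_union, mem_union, Finset.mem_coe, not_or] at hzF
    obtain ⟨y, hy, hzy⟩ : ∃ y ∈ S, z < y := by
      by_contra! hle
      have hb : BddAbove S := ⟨z, hle⟩
      refine hzF.1 ?_
      rw [if_pos hb, Finset.mem_singleton]
      refine le_antisymm ?_ (csSup_le hne hle)
      exact closure_minimal (fun s hs => le_csSup hb hs) isClosed_Iic hz.1
    obtain ⟨x, hx, hxz⟩ : ∃ x ∈ S, x < z := by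
      by_contra! hle
      have hb : BddBelow S := ⟨z, hle⟩
      refine hzF.2 ?_
      rw [if_pos hb, Finset.mem_singleton]
      refine le_antisymm (le_csInf hne hle) ?_
      exact closure_minimal (fun s hs => csInf_le hb hs) isClosed_Ici hz.1
    refine hz.2 (mem_interior.2 ⟨Ioo x y, ?_, isOpen_Ioo, hxz, hzy⟩)
    exact Ioo_subset_Icc_self.trans (hS.out hx hy)
  · have := Finset.card_union_le (if BddAbove S then {sSup S} else ∅ : Finset ℝ)
      (if BddBelow S then {sInf S} else ∅)
    split_ifs at this ⊢ <;> simp at this ⊢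
    all_goals omega

theorem IsPreconnected.subset_or_disjoint_of_disjoint_frontier {I S : Set ℝ}
    (hI : IsPreconnected I) (h : Disjoint I (frontier S)) : I ⊆ S ∨ Disjoint I S := by
  have hcov : I ⊆ interior S ∪ interior Sᶜ := fun z hz => by
    by_contra hzn
    rw [mem_union, not_or, interior_compl] at hzn
    exact disjoint_left.1 h hz ⟨not_not.1 hzn.2, hzn.1⟩
  refine (hI.subset_or_subset isOpen_interior isOpen_interior ?_ hcov).imp
    (fun h => h.trans interior_subset) fun h => disjoint_left.2 fun z hz => interior_subset (h hz)
  exact disjoint_compl_right.mono interior_subset interior_subset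

section

variable {E : Type*} [NormedAddCommGroup E] [NormedSpace ℝ E]

theorem isLinearOn_of_subsingleton (f : ℝ → E) {I : Set ℝ} (hI : I.Subsingleton) :
    IsLinearOn f I := by
  rcases I.eq_empty_or_nonempty with rfl | ⟨z, hz⟩
  · exact ⟨0, 0, fun α hα => hα.elim⟩
  · exact ⟨f z, 0, fun α hα => by rw [hI hα hz]; simp⟩

theorem IsLinearOn.of_interior {f : ℝ → E} (hf : Continuous f) {I : Set ℝ} (hI : I.OrdConnected)
    (h : IsLinearOn f (interior I)) : IsLinearOn f I := by
  rcases (interior I).eq_empty_or_nonempty with he | hne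
  · refine isLinearOn_of_subsingleton f fun x hx y hy => ?_
    by_contra hxy
    wlog hlt : x < y generalizing x y
    · exact this y hy x hx (Ne.symm hxy) (lt_of_le_of_ne (not_lt.1 hlt) (Ne.symm hxy))
    have : Ioo x y ⊆ interior I :=
      interior_maximal (Ioo_subset_Icc_self.trans (hI.out hx hy)) isOpen_Ioo
    rw [he] at this
    obtain ⟨z, hz⟩ := nonempty_Ioo.2 hlt
    exact this hz
  · obtain ⟨a, b, hab⟩ := h
    refine ⟨a, b, fun α hα => ?_⟩
    have hcl : α ∈ closure (interior I) := by
      rw [(hI.convex (𝕜 := ℝ)).closure_interior_eq_closure_of_nonempty_interior hne]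
      exact subset_closure hα
    have : IsClosed {z | f z = a + z • b} := isClosed_eq hf (by fun_prop)
    exact closure_minimal (fun z hz => hab z hz) this hcl

/-- A continuous curve which is linear wherever membership in each of finitely many convex sets
covering the line is constant. -/
theorem exists_isSegmentation_card_le {ι : Type*} [Fintype ι] {f : ℝ → E} (hf : Continuous f)
    (Y : ι → Set ℝ) (hY : ∀ j, (Y j).OrdConnected) (hcov : ∀ α, ∃ j, α ∈ Y j)
    (hlin : ∀ I : Set ℝ, IsPreconnected I → (∀ j, I ⊆ Y j ∨ Disjoint I (Y j)) →
      IsLinearOn f I) :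
    ∃ B, IsSegmentation f B ∧ B.card + 2 ≤ 2 * Fintype.card ι := by
  classical
  choose F hF hcard using fun j => (hY j).exists_frontier_subset
  refine ⟨Finset.univ.biUnion F, fun I hI hd => ?_, ?_⟩
  · refine IsLinearOn.of_interior hf hI (hlin _ ?_ fun j => ?_)
    · exact (hI.convex (𝕜 := ℝ)).interior.isPreconnected
    · refine (hI.convex (𝕜 := ℝ)).interior.isPreconnected.subset_or_disjoint_of_disjoint_frontier ?_
      refine hd.mono_right ((hF j).trans fun z hz => ?_)
      simpa using ⟨j, hz⟩
  · have hc : (Finset.univ.biUnion F).card ≤ ∑ j, (F j).card := Finset.card_biUnion_le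
    have hs := Finset.sum_le_sum fun j (_ : j ∈ Finset.univ) => hcard j
    rw [Finset.sum_add_distrib, Finset.sum_add_distrib, Finset.sum_const, smul_eq_mul,
      Finset.card_univ] at hs
    -- A finite union of sets bounded above is bounded above, so a cover of `ℝ` has a member
    -- unbounded above, and likewise one unbounded below. Each saves one endpoint.
    have hU : (⋃ j, Y j) = univ := eq_univ_of_forall fun α => mem_iUnion.2 (hcov α)
    have ha : 1 ≤ ∑ j, (if BddAbove (Y j) then 0 else 1) := by
      obtain ⟨j, hj⟩ : ∃ j, ¬ BddAbove (Y j) := by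
        by_contra! hall
        have := (finite_univ.bddAbove_biUnion (S := Y)).2 fun j _ => hall j
        rw [biUnion_univ, hU] at this
        exact not_bddAbove_univ this
      exact (if_neg hj).symm.le.trans (Finset.single_le_sum
        (f := fun j => if BddAbove (Y j) then 0 else 1) (fun _ _ => Nat.zero_le _)
        (Finset.mem_univ j))
    have hb : 1 ≤ ∑ j, (if BddBelow (Y j) then 0 else 1) := by
      obtain ⟨j, hj⟩ : ∃ j, ¬ BddBelow (Y j) := by
        by_contra! hall
        have := (finite_univ.bddBelow_biUnion (S := Y)).2 fun j _ => hall j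
        rw [biUnion_univ, hU] at this
        exact not_bddBelow_univ this
      exact (if_neg hj).symm.le.trans (Finset.single_le_sum
        (f := fun j => if BddBelow (Y j) then 0 else 1) (fun _ _ => Nat.zero_le _)
        (Finset.mem_univ j))
    omega

end

/-! ### The upper bound -/

/-- Along the line the norm is convex and piecewise affine, with kinks only where a nonconstant
coordinate vanishes, so moving to a suitable kink never increases it. -/
theorem exists_coord_zero_weightedOneNorm_le {n : ℕ} {w : Fin n → ℝ} (hw : ∀ i, 0 < w i)
    {x d : EuclideanSpace ℝ (Fin n)} (hd : d ≠ 0) (α : ℝ) :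
    ∃ (c : ℝ) (i : Fin n), x i + c * d i = 0 ∧
      weightedOneNorm w (x + c • d) ≤ weightedOneNorm w (x + α • d) := by
  classical
  have hN : ∀ β, weightedOneNorm w (x + β • d) = ∑ i, w i * |x i + β * d i| := fun β => rfl
  set Z : Finset ℝ := (Finset.univ.filter fun i => d i ≠ 0).image fun i => -x i / d i with hZ
  have hZmem : ∀ z ∈ Z, ∃ i, x i + z * d i = 0 := fun z hz => by
    simp only [hZ, Finset.mem_image, Finset.mem_filter, Finset.mem_univ, true_and] at hz
    obtain ⟨i, hi, rfl⟩ := hz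
    exact ⟨i, by field_simp; ring⟩
  have hterm : ∀ i, d i ≠ 0 → ∃ z ∈ Z, ∀ β, |x i + β * d i| = |d i| * |β - z| := fun i hi => by
    refine ⟨-x i / d i, ?_, fun β => ?_⟩
    · simp only [hZ, Finset.mem_image, Finset.mem_filter, Finset.mem_univ, true_and]
      exact ⟨i, hi, rfl⟩
    · rw [← abs_mul]
      congr 1
      field_simp
      ring
  have hZne : Z.Nonempty := by
    obtain ⟨i, hi⟩ : ∃ i, d i ≠ 0 := by
      by_contra! h
      exact hd (PiLp.ext h)
    obtain ⟨z, hz, -⟩ := hterm i hi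
    exact ⟨z, hz⟩
  have hone : ∀ c, (∀ z ∈ Z, |c - z| ≤ |α - z|) →
      weightedOneNorm w (x + c • d) ≤ weightedOneNorm w (x + α • d) := by
    intro c hc
    rw [hN, hN]
    refine Finset.sum_le_sum fun i _ => mul_le_mul_of_nonneg_left ?_ (hw i).le
    by_cases hi : d i = 0
    · simp [hi]
    · obtain ⟨z, hz, e⟩ := hterm i hi
      rw [e, e]
      exact mul_le_mul_of_nonneg_left (hc z hz) (abs_nonneg _)
  by_cases hL : ∃ z ∈ Z, z ≤ α
  swap
  · push Not at hL
    obtain ⟨i, hi⟩ := hZmem _ (Z.min'_mem hZne)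
    refine ⟨_, i, hi, hone _ fun z hz => ?_⟩
    have h1 := hL _ (Z.min'_mem hZne)
    have h2 := Z.min'_le z hz
    rw [abs_of_nonpos (by linarith), abs_of_nonpos (by linarith)]
    linarith
  by_cases hR : ∃ z ∈ Z, α ≤ z
  swap
  · push Not at hR
    obtain ⟨i, hi⟩ := hZmem _ (Z.max'_mem hZne)
    refine ⟨_, i, hi, hone _ fun z hz => ?_⟩
    have h1 := hR _ (Z.max'_mem hZne)
    have h2 := Z.le_max' z hz
    rw [abs_of_nonneg (by linarith), abs_of_nonneg (by linarith)]
    linarith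
  have hLne : (Z.filter (· ≤ α)).Nonempty := by
    obtain ⟨z, hz, h⟩ := hL
    exact ⟨z, Finset.mem_filter.2 ⟨hz, h⟩⟩
  have hRne : (Z.filter (α ≤ ·)).Nonempty := by
    obtain ⟨z, hz, h⟩ := hR
    exact ⟨z, Finset.mem_filter.2 ⟨hz, h⟩⟩
  obtain ⟨l, hl, hlmax⟩ := (Z.filter (· ≤ α)).exists_max_image id hLne
  obtain ⟨r, hr, hrmin⟩ := (Z.filter (α ≤ ·)).exists_min_image id hRne
  simp only [Finset.mem_filter, id, and_imp] at hl hlmax hr hrmin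
  obtain ⟨i, hi⟩ := hZmem l hl.1
  rcases hl.2.eq_or_lt with rfl | hlα
  · exact ⟨l, i, hi, le_rfl⟩
  obtain ⟨j, hj⟩ := hZmem r hr.1
  have hlr : 0 < r - l := by linarith [hr.2]
  -- No kink lies strictly between `l` and `r`, so the norm is affine there and one of the two ends
  -- is no worse than `α`.
  have key : (r - α) * weightedOneNorm w (x + l • d) + (α - l) * weightedOneNorm w (x + r • d) ≤
      (r - l) * weightedOneNorm w (x + α • d) := by
    rw [hN, hN, hN, Finset.mul_sum, Finset.mul_sum, Finset.mul_sum, ← Finset.sum_add_distrib]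
    refine Finset.sum_le_sum fun i _ => ?_
    by_cases hi : d i = 0
    · simp only [hi, mul_zero, add_zero]
      exact le_of_eq (by ring)
    · obtain ⟨z, hz, e⟩ := hterm i hi
      rw [e, e, e]
      have : (r - α) * |l - z| + (α - l) * |r - z| ≤ (r - l) * |α - z| := by
        rcases le_total z α with h | h
        · have := hlmax z hz h
          rw [abs_of_nonneg (by linarith), abs_of_nonneg (by linarith),
            abs_of_nonneg (by linarith)]
          exact le_of_eq (by ring)
        · have := hrmin z hz h
          rw [abs_of_nonpos (by linarith), abs_of_nonpos (by linarith),
            abs_of_nonpos (by linarith)]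
          exact le_of_eq (by ring)
      have := mul_le_mul_of_nonneg_left this (mul_nonneg (hw i).le (abs_nonneg (d i)))
      linarith
  by_contra! hno
  have h1 := hno l i hi
  have h2 := hno r j hj
  nlinarith [hr.2]

/-- Lets the point `c`, where a slack may be exactly zero, be adjoined to an active interval, so
that the intervals of the two signs can be joined at `c`. -/
theorem ConcaveOn.convex_insert {h : ℝ → ℝ} (hh : ConcaveOn ℝ univ h) {c : ℝ} (hc : 0 ≤ h c) :
    Convex ℝ (insert c {α | 0 < h α}) := by
  rw [convex_iff_forall_pos]
  rintro x hx y hy a b ha hb hab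
  have key := hh.2 (mem_univ x) (mem_univ y) ha.le hb.le hab
  simp only [smul_eq_mul] at key ⊢
  rcases hx with rfl | hx <;> rcases hy with rfl | hy
  · exact Or.inl (by rw [← add_mul, hab, one_mul])
  all_goals
    right
    rw [mem_ofPred_eq] at *
    first
    | nlinarith [mul_pos hb hy, mul_nonneg ha.le hc]
    | nlinarith [mul_pos ha hx, mul_nonneg hb.le hc]

section

variable {n : ℕ} {w : Fin n → ℝ} (hw : ∀ i, 0 < w i) {τ : ℝ} (hτ : 0 < τ)
  (x d : EuclideanSpace ℝ (Fin n))

include hw hτ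

/-- The slack `s * v i - λ * w i` of the `i`-th coordinate with sign `s` is concave. -/
theorem concaveOn_slack (s : ℝ) (i : Fin n) :
    ConcaveOn ℝ univ fun α => s * (x i + α * d i) - threshold w τ (x + α • d) * w i := by
  refine ⟨convex_univ, fun α _ β _ a b ha hb hab => ?_⟩
  have h := (convexOn_threshold hw hτ x d).2 (mem_univ α) (mem_univ β) ha hb hab
  have := mul_le_mul_of_nonneg_right h (hw i).le
  simp only [smul_eq_mul] at this ⊢
  have e : s * (x i + (a * α + b * β) * d i) =
      a * (s * (x i + α * d i)) + b * (s * (x i + β * d i)) := by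
    linear_combination (-s * x i) * hab
  linarith

theorem continuous_slack (s : ℝ) (i : Fin n) :
    Continuous fun α => s * (x i + α * d i) - threshold w τ (x + α • d) * w i := by
  have := continuous_threshold hw hτ x d
  fun_prop

theorem projectedLine_of_threshold_eq_zero {α : ℝ} (h : threshold w τ (x + α • d) = 0) :
    projectedLine w τ x d α = x + α • d :=
  PiLp.ext fun i => by
    rw [projectedLine_apply hw hτ, h, zero_mul, softThreshold_zero]
    rfl

theorem weightedOneNorm_projectedLine {α : ℝ} (h : 0 < threshold w τ (x + α • d)) :
    ∑ i, w i * |projectedLine w τ x d α i| = τ := by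
  obtain ⟨h0, -, h2⟩ := threshold_spec hw hτ (x + α • d)
  refine Eq.trans ?_ (h2 h)
  refine Finset.sum_congr rfl fun i _ => ?_
  rw [projectedLine_apply hw hτ, abs_softThreshold (mul_nonneg h0 (hw i).le)]
  rfl

/-- With constant signs, the constraint that the norm equals `τ` is one linear equation in `α` and
the multiplier, which can be solved for the multiplier. -/
theorem isLinearOn_projectedLine_of_active {I : Set ℝ}
    (hI : ∀ α ∈ I, 0 < threshold w τ (x + α • d))
    (h1 : ∀ i, (∀ α ∈ I, threshold w τ (x + α • d) * w i < x i + α * d i) ∨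
      ∀ α ∈ I, x i + α * d i ≤ threshold w τ (x + α • d) * w i)
    (h2 : ∀ i, (∀ α ∈ I, threshold w τ (x + α • d) * w i < -(x i + α * d i)) ∨
      ∀ α ∈ I, -(x i + α * d i) ≤ threshold w τ (x + α • d) * w i) :
    IsLinearOn (projectedLine w τ x d) I := by
  rcases I.eq_empty_or_nonempty with rfl | ⟨α₀, hα₀⟩
  · exact ⟨0, 0, fun α hα => hα.elim⟩
  -- The equation `s ^ 3 = s` encodes `s ∈ {-1, 0, 1}`, treating positive, inactive and negative
  -- coordinates by one formula.
  have hs : ∀ i, ∃ s : ℝ, s ^ 3 = s ∧ ∀ α ∈ I,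
      projectedLine w τ x d α i =
        s ^ 2 * (x i + α * d i) - s * (threshold w τ (x + α • d) * w i) ∧
      |projectedLine w τ x d α i| = s * projectedLine w τ x d α i := by
    intro i
    have hc : ∀ α ∈ I, 0 ≤ threshold w τ (x + α • d) * w i := fun α hα =>
      mul_nonneg (hI α hα).le (hw i).le
    rcases h1 i with h | h
    · refine ⟨1, by norm_num, fun α hα => ?_⟩
      rw [projectedLine_apply hw hτ, softThreshold_of_lt (hc α hα) (h α hα)]
      exact ⟨by ring, by rw [one_mul, abs_of_pos (by linarith [h α hα])]⟩
    rcases h2 i with h' | h'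
    · refine ⟨-1, by norm_num, fun α hα => ?_⟩
      rw [projectedLine_apply hw hτ, softThreshold_of_lt_neg (hc α hα) (h' α hα)]
      exact ⟨by ring, by rw [abs_of_neg (by linarith [h' α hα])]; ring⟩
    · refine ⟨0, by norm_num, fun α hα => ?_⟩
      rw [projectedLine_apply hw hτ, softThreshold_of_abs_le
        (abs_le.2 ⟨by linarith [h' α hα], h α hα⟩)]
      simp
  choose s hs3 hs using hs
  set A := ∑ i, w i * s i * x i
  set A' := ∑ i, w i * s i * d i
  set D := ∑ i, (s i * w i) ^ 2 with hD
  have hlam : ∀ α ∈ I, A + α * A' - threshold w τ (x + α • d) * D = τ := by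
    intro α hα
    refine Eq.trans ?_ (weightedOneNorm_projectedLine hw hτ x d (hI α hα))
    rw [Finset.mul_sum, Finset.mul_sum,
      ← Finset.sum_add_distrib, ← Finset.sum_sub_distrib]
    refine Finset.sum_congr rfl fun i _ => ?_
    rw [(hs i α hα).2, (hs i α hα).1]
    linear_combination (-(w i * (x i + α * d i))) * hs3 i
  -- If `D = 0`, all signs vanish and the norm would be `0`, not `τ`.
  have hD0 : D ≠ 0 := by
    intro h
    have hz : ∀ i, s i = 0 := fun i => by
      have := (Finset.sum_eq_zero_iff_of_nonneg fun i _ => sq_nonneg (s i * w i)).1 h i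
        (Finset.mem_univ i)
      exact (mul_eq_zero.1 (pow_eq_zero_iff two_ne_zero |>.1 this)).resolve_right (hw i).ne'
    have := hlam α₀ hα₀
    simp only [A, A', h, hz, mul_zero, zero_mul, Finset.sum_const_zero] at this
    linarith
  refine ⟨WithLp.toLp 2 fun i => s i ^ 2 * x i - s i * w i * ((A - τ) / D),
    WithLp.toLp 2 fun i => s i ^ 2 * d i - s i * w i * (A' / D), fun α hα => PiLp.ext fun i => ?_⟩
  rw [(hs i α hα).1]
  have : threshold w τ (x + α • d) = (A - τ) / D + α * (A' / D) := by
    field_simp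
    linarith [hlam α hα]
  rw [this]
  simp only [PiLp.add_apply, PiLp.smul_apply, smul_eq_mul]
  ring

theorem exists_active {α : ℝ} (h : 0 < threshold w τ (x + α • d)) :
    ∃ i, threshold w τ (x + α • d) * w i < |x i + α * d i| := by
  by_contra! hno
  have := weightedOneNorm_projectedLine hw hτ x d h
  rw [Finset.sum_eq_zero fun i _ => by
    rw [projectedLine_apply hw hτ, softThreshold_of_abs_le (hno i)]; simp] at this
  exact hτ.ne this

theorem exists_isSegmentation_projectedLine (hn : 1 ≤ n) :
    ∃ B, IsSegmentation (projectedLine w τ x d) B ∧ B.card + 2 ≤ 4 * n := by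
  classical
  by_cases hd : d = 0
  · refine ⟨∅, fun I _ _ => ⟨projectedLine w τ x d 0, 0, fun α _ => ?_⟩, by simp; omega⟩
    simp [projectedLine, hd]
  set lam : ℝ → ℝ := fun α => threshold w τ (x + α • d) with hlam
  have hlam0 : ∀ α, 0 ≤ lam α := fun α => (threshold_spec hw hτ _).1
  set s : Bool → ℝ := fun b => if b then 1 else -1 with hs
  set J : Fin n × Bool → Set ℝ := fun j =>
    {α | 0 < s j.2 * (x j.1 + α * d j.1) - lam α * w j.1} with hJdef
  have hJc : ∀ j, (J j).OrdConnected := fun j => by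
    have := (concaveOn_slack hw hτ x d (s j.2) j.1).convex_gt 0
    simp only [mem_univ, true_and] at this
    exact this.ordConnected
  have hJo : ∀ j, IsOpen (J j) := fun j =>
    isOpen_lt continuous_const (continuous_slack hw hτ x d (s j.2) j.1)
  have hJact : ∀ α, 0 < lam α → ∃ j, α ∈ J j := fun α hα => by
    obtain ⟨i, hi⟩ := exists_active hw hτ x d hα
    rcases lt_abs.1 hi with h | h
    · exact ⟨(i, true), by simp only [hJdef, hs, mem_ofPred_eq, if_true]; linarith⟩
    · refine ⟨(i, false), ?_⟩
      simp only [hJdef, hs, mem_ofPred_eq, Bool.false_eq_true, if_false]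
      linarith
  have hJlin : ∀ I : Set ℝ, (∀ α ∈ I, 0 < lam α) → (∀ j, I ⊆ J j ∨ Disjoint I (J j)) →
      IsLinearOn (projectedLine w τ x d) I := by
    intro I hI hj
    refine isLinearOn_projectedLine_of_active hw hτ x d hI (fun i => ?_) fun i => ?_
    · refine (hj (i, true)).imp (fun h α hα => ?_) fun h α hα => ?_
      · have := h hα
        simp only [hJdef, hs, mem_ofPred_eq, if_true] at this
        linarith
      · have := disjoint_left.1 h hα
        simp only [hJdef, hs, mem_ofPred_eq, if_true] at this
        linarith
    · refine (hj (i, false)).imp (fun h α hα => ?_) fun h α hα => ?_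
      · have := h hα
        simp only [hJdef, hs, mem_ofPred_eq, Bool.false_eq_true, if_false] at this
        linarith
      · have := disjoint_left.1 h hα
        simp only [hJdef, hs, mem_ofPred_eq, Bool.false_eq_true, if_false] at this
        linarith
  have hcard : 2 * Fintype.card (Fin n × Bool) = 4 * n := by
    simp only [Fintype.card_prod, Fintype.card_fin, Fintype.card_bool]
    ring
  rw [← hcard]
  have hcont := continuous_projectedLine hw hτ x d
  by_cases hK : ∀ α, 0 < lam α
  · exact exists_isSegmentation_card_le hcont J hJc (fun α => hJact α (hK α))
      fun I _ hI => hJlin I (fun α _ => hK α) hI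
  push Not at hK
  obtain ⟨α₀, hα₀⟩ := hK
  obtain ⟨c, i₀, hc, hcle⟩ := exists_coord_zero_weightedOneNorm_le hw hd (x := x) α₀
  have hlamc : lam c = 0 := (threshold_eq_zero_iff hw hτ _).2 (hcle.trans
    ((threshold_eq_zero_iff hw hτ _).1 (le_antisymm hα₀ (hlam0 α₀))))
  set K : Set ℝ := {α | lam α ≤ 0} with hKdef
  -- Both slacks of `i₀` vanish at `c`, so `S` is a single interval. It takes the slot `(i₀, true)`,
  -- and the freed slot `(i₀, false)` goes to `K`.
  set S : Set ℝ := insert c (J (i₀, true)) ∪ insert c (J (i₀, false)) with hSdef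
  have hSc : S.OrdConnected := by
    have : ∀ b, IsPreconnected (insert c (J (i₀, b))) := fun b =>
      ((concaveOn_slack hw hτ x d (s b) i₀).convex_insert (c := c)
        (by change 0 ≤ s b * _ - lam c * _; rw [hlamc, hc]; simp)).isPreconnected
    exact ((this true).union c (mem_insert _ _) (mem_insert _ _) (this false)).ordConnected
  have hKc : K.OrdConnected := by
    have := (convexOn_threshold hw hτ x d).convex_le 0
    simp only [mem_univ, true_and] at this
    exact this.ordConnected
  refine exists_isSegmentation_card_le hcont
    (fun j => if j.1 = i₀ then (if j.2 then S else K) else J j) (fun j => ?_) (fun α => ?_)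
    fun I hIp hI => ?_
  · split_ifs
    exacts [hSc, hKc, hJc j]
  · rcases (hlam0 α).eq_or_lt with h | h
    · refine ⟨(i₀, false), ?_⟩
      simp only [if_true, Bool.false_eq_true, if_false]
      exact h.symm.le
    · obtain ⟨⟨i, b⟩, hj⟩ := hJact α h
      by_cases hi : i = i₀
      · subst hi
        refine ⟨(i, true), ?_⟩
        simp only [if_true]
        cases b
        · exact Or.inr (Or.inr hj)
        · exact Or.inl (Or.inr hj)
      · exact ⟨(i, b), by simp only [hi, if_false]; exact hj⟩
  · have hIK := hI (i₀, false)
    simp only [if_true, Bool.false_eq_true, if_false] at hIK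
    rcases hIK with hIK | hIK
    · exact ⟨x, d, fun α hα => projectedLine_of_threshold_eq_zero hw hτ x d
        (le_antisymm (hIK hα) (hlam0 α))⟩
    have hpos : ∀ α ∈ I, 0 < lam α := fun α hα => not_le.1 (disjoint_left.1 hIK hα)
    have hcI : c ∉ I := fun h => (hpos c h).ne' hlamc
    refine hJlin I hpos fun ⟨i, b⟩ => ?_
    by_cases hi : i = i₀
    · subst hi
      have hIS := hI (i, true)
      simp only [if_true] at hIS
      rcases hIS with hIS | hIS
      -- As `c` lies in `K`, it is not in `I`; the connected set `I` then lies in just one of the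
      -- two disjoint open active intervals.
      · have hsub : I ⊆ J (i, true) ∪ J (i, false) := fun α hα => by
          rcases hIS hα with (h | h) | (h | h)
          · exact absurd (h ▸ hα) hcI
          · exact Or.inl h
          · exact absurd (h ▸ hα) hcI
          · exact Or.inr h
        have hdis : Disjoint (J (i, true)) (J (i, false)) := by
          refine disjoint_left.2 fun α h1 h2 => ?_
          simp only [hJdef, hs, mem_ofPred_eq, if_true, Bool.false_eq_true, if_false] at h1 h2
          have := mul_nonneg (hlam0 α) (hw i).le
          linarith
        rcases hIp.subset_or_subset (hJo _) (hJo _) hdis hsub with h | h <;> cases b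
        · exact Or.inr (hdis.mono_left h)
        · exact Or.inl h
        · exact Or.inl h
        · exact Or.inr (hdis.symm.mono_left h)
      · refine Or.inr (hIS.mono_right fun α hα => ?_)
        cases b
        · exact Or.inr (Or.inr hα)
        · exact Or.inl (Or.inr hα)
    · have := hI (i, b)
      simp only [hi, if_false] at this
      exact this

end

/-! ### Points that every segmentation must contain -/

-- By concavity, `h` is positive just after leaving `q` towards `y` and negative just after leaving
-- it in the opposite direction.
open Filter Topology in
theorem ConcaveOn.frequently_sign {h : ℝ → ℝ} (hh : ConcaveOn ℝ univ h) {y q : ℝ} (hy : 0 < h y)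
    (hq : h q = 0) : (∃ᶠ z in 𝓝[≠] q, 0 < h z) ∧ ∃ᶠ z in 𝓝[≠] q, h z < 0 := by
  have hyq : y - q ≠ 0 := fun e => by
    rw [sub_eq_zero.1 e, hq] at hy
    exact lt_irrefl _ hy
  have ht : ∀ c : ℝ, c ≠ 0 → Tendsto (fun t => q + t * c) (𝓝[>] (0 : ℝ)) (𝓝[≠] q) := by
    intro c hc
    refine tendsto_nhdsWithin_iff.2 ⟨?_, ?_⟩
    · have : Continuous fun t : ℝ => q + t * c := by fun_prop
      have := (this.tendsto 0).mono_left (nhdsWithin_le_nhds (s := Ioi 0))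
      simpa using this
    · filter_upwards [self_mem_nhdsWithin] with t ht
      have := mul_ne_zero (ne_of_gt (show 0 < t from ht)) hc
      simpa using this
  constructor
  · refine (ht (y - q) hyq).frequently (Eventually.frequently ?_)
    filter_upwards [Ioo_mem_nhdsGT (zero_lt_one (α := ℝ))] with t ht
    have := hh.2 (mem_univ y) (mem_univ q) ht.1.le (sub_nonneg.2 ht.2.le) (by ring)
    simp only [smul_eq_mul, hq, mul_zero, add_zero] at this
    rw [show t * y + (1 - t) * q = q + t * (y - q) by ring] at this
    exact (mul_pos ht.1 hy).trans_le this
  · refine (ht (q - y) (by rw [← neg_sub]; exact neg_ne_zero.2 hyq)).frequently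
      (Eventually.frequently ?_)
    filter_upwards [self_mem_nhdsWithin] with t ht
    have ht : 0 < t := ht
    have ht1 : 0 < 1 + t := by linarith
    have := hh.2 (mem_univ y) (mem_univ (q + t * (q - y)))
      (by positivity : 0 ≤ t / (1 + t)) (by positivity : 0 ≤ 1 / (1 + t)) (by field_simp; ring)
    simp only [smul_eq_mul] at this
    rw [show t / (1 + t) * y + 1 / (1 + t) * (q + t * (q - y)) = q by field_simp; ring, hq,
      show t / (1 + t) * h y + 1 / (1 + t) * h (q + t * (q - y)) =
        (t * h y + h (q + t * (q - y))) / (1 + t) by field_simp] at this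
    have h1 : t * h y + h (q + t * (q - y)) ≤ 0 := by
      by_contra! hlt
      exact absurd (div_pos hlt ht1) (not_lt.2 this)
    linarith [mul_pos ht hy]

-- An affine piece around `q` that agrees with `a + z * b` at `q` and at one other point agrees with
-- it throughout the piece.
open Filter Topology in
theorem IsSegmentation.mem_of_frequently {n : ℕ} {p : ℝ → EuclideanSpace ℝ (Fin n)} {B : Finset ℝ}
    (hB : IsSegmentation p B) {q : ℝ} (i : Fin n) (a b : ℝ) (hq : p q i = a + q * b)
    (heq : ∃ᶠ z in 𝓝[≠] q, p z i = a + z * b) (hne : ∃ᶠ z in 𝓝[≠] q, p z i ≠ a + z * b) :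
    q ∈ B := by
  by_contra hqB
  have hopen : (B : Set ℝ)ᶜ ∈ 𝓝 q := B.finite_toSet.isClosed.isOpen_compl.mem_nhds hqB
  obtain ⟨ε, hε, hball⟩ := Metric.mem_nhds_iff.1 hopen
  obtain ⟨A, C, hAC⟩ := hB (Metric.ball q ε) (by rw [Real.ball_eq_Ioo]; exact ordConnected_Ioo)
    (disjoint_left.2 fun z hz => hball (interior_subset hz))
  have hAC' : ∀ z ∈ Metric.ball q ε, p z i = A i + z * C i := fun z hz => by
    rw [hAC z hz]; simp
  have hev : ∀ᶠ z in 𝓝[≠] q, z ∈ Metric.ball q ε :=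
    nhdsWithin_le_nhds (Metric.ball_mem_nhds q hε)
  obtain ⟨z, ⟨hz, hzb⟩, hzq⟩ := ((heq.and_eventually hev).and_eventually
    self_mem_nhdsWithin).exists
  obtain ⟨y, hy, hyb⟩ := (hne.and_eventually hev).exists
  rw [hAC' _ (Metric.mem_ball_self hε)] at hq
  rw [hAC' _ hzb] at hz
  have h1 : (z - q) * (C i - b) = 0 := by linear_combination hz - hq
  have h2 := (mul_eq_zero.1 h1).resolve_left (sub_ne_zero.2 hzq)
  refine hy ?_
  rw [hAC' _ hyb]
  linear_combination hq + (y - q) * h2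

theorem exists_root_right {h : ℝ → ℝ} (hc : Continuous h) {a b : ℝ} (hab : a ≤ b)
    (ha : 0 < h a) (hb : h b < 0) : ∃ q, a < q ∧ q < b ∧ h q = 0 := by
  obtain ⟨q, hq, e⟩ := intermediate_value_Ioo' hab hc.continuousOn (mem_Ioo.2 ⟨hb, ha⟩)
  exact ⟨q, hq.1, hq.2, e⟩

theorem exists_root_left {h : ℝ → ℝ} (hc : Continuous h) {a b : ℝ} (hab : a ≤ b)
    (ha : h a < 0) (hb : 0 < h b) : ∃ q, a < q ∧ q < b ∧ h q = 0 := by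
  obtain ⟨q, hq, e⟩ := intermediate_value_Ioo hab hc.continuousOn (mem_Ioo.2 ⟨ha, hb⟩)
  exact ⟨q, hq.1, hq.2, e⟩

section

variable {n : ℕ} {w : Fin n → ℝ} (hw : ∀ i, 0 < w i) {τ : ℝ} (hτ : 0 < τ)
  (x d : EuclideanSpace ℝ (Fin n))

theorem concaveOn_sub_weightedOneNorm (hw : ∀ i, 0 < w i) (τ : ℝ) :
    ConcaveOn ℝ univ fun α : ℝ => τ - weightedOneNorm w (x + α • d) := by
  refine ⟨convex_univ, fun α _ β _ a b ha hb hab => ?_⟩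
  have : weightedOneNorm w (x + (a * α + b * β) • d) ≤
      a * weightedOneNorm w (x + α • d) + b * weightedOneNorm w (x + β • d) := by
    unfold weightedOneNorm
    rw [Finset.mul_sum, Finset.mul_sum, ← Finset.sum_add_distrib]
    refine Finset.sum_le_sum fun i _ => ?_
    simp only [PiLp.add_apply, PiLp.smul_apply, smul_eq_mul]
    have e : x i + (a * α + b * β) * d i = a * (x i + α * d i) + b * (x i + β * d i) := by
      linear_combination (-x i) * hab
    have h : |x i + (a * α + b * β) * d i| ≤ a * |x i + α * d i| + b * |x i + β * d i| := by
      rw [e]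
      refine (abs_add_le _ _).trans_eq ?_
      rw [abs_mul, abs_mul, abs_of_nonneg ha, abs_of_nonneg hb]
    have := mul_le_mul_of_nonneg_left h (hw i).le
    linarith
  simp only [smul_eq_mul]
  have e3 : a * τ + b * τ = τ := by rw [← add_mul, hab, one_mul]
  linarith

theorem continuous_sub_weightedOneNorm (w : Fin n → ℝ) (τ : ℝ) :
    Continuous fun α : ℝ => τ - weightedOneNorm w (x + α • d) := by
  unfold weightedOneNorm
  fun_prop

include hw hτ

open Filter Topology in
/-- A coordinate enters or leaves the support at each zero of its slack. -/
theorem mem_of_slack_eq_zero {B : Finset ℝ} (hB : IsSegmentation (projectedLine w τ x d) B)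
    {s : ℝ} (hs : s = 1 ∨ s = -1) (i : Fin n) {y q : ℝ}
    (hy : 0 < s * (x i + y * d i) - threshold w τ (x + y • d) * w i)
    (hq : s * (x i + q * d i) - threshold w τ (x + q • d) * w i = 0)
    (hpos : 0 < threshold w τ (x + q • d)) : q ∈ B := by
  obtain ⟨h1, h2⟩ := (concaveOn_slack hw hτ x d s i).frequently_sign hy hq
  have hlw : ∀ z : ℝ, 0 ≤ threshold w τ (x + z • d) * w i := fun z =>
    mul_nonneg (threshold_spec hw hτ _).1 (hw i).le
  -- Near `q` the coordinate keeps the sign `s`, so a negative slack means it is thresholded to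
  -- zero, not active with the opposite sign.
  have hev : ∀ᶠ z in 𝓝[≠] q, 0 < s * (x i + z * d i) := by
    refine nhdsWithin_le_nhds ((isOpen_lt continuous_const (by fun_prop)).mem_nhds ?_)
    change 0 < s * (x i + q * d i)
    rw [sub_eq_zero.1 hq]
    exact mul_pos hpos (hw i)
  refine hB.mem_of_frequently i 0 0 ?_ ((h2.and_eventually hev).mono ?_) (h1.mono ?_)
  · rw [projectedLine_apply hw hτ, softThreshold_of_abs_le, mul_zero, add_zero]
    rw [← sub_eq_zero.1 hq]
    rcases hs with rfl | rfl
    · rw [abs_le]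
      have := hlw q
      constructor <;> linarith
    · rw [abs_le]
      have := hlw q
      constructor <;> linarith
  · rintro z ⟨hz, hz'⟩
    rw [projectedLine_apply hw hτ, softThreshold_of_abs_le, mul_zero, add_zero]
    rw [abs_le]
    have := hlw z
    rcases hs with rfl | rfl <;> constructor <;> linarith
  · intro z hz
    rw [projectedLine_apply hw hτ, mul_zero, add_zero]
    rcases hs with rfl | rfl
    · rw [softThreshold_of_lt (hlw z) (by linarith)]
      linarith
    · rw [softThreshold_of_lt_neg (hlw z) (by linarith)]
      linarith

open Filter Topology in
/-- The line enters or leaves the ball at a breakpoint. -/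
theorem mem_of_weightedOneNorm_eq {B : Finset ℝ} (hB : IsSegmentation (projectedLine w τ x d) B)
    {y q : ℝ} (hy : weightedOneNorm w (x + y • d) < τ) (hq : weightedOneNorm w (x + q • d) = τ) :
    q ∈ B := by
  obtain ⟨h1, h2⟩ := (concaveOn_sub_weightedOneNorm x d hw τ).frequently_sign
    (sub_pos.2 hy) (sub_eq_zero.2 hq.symm)
  obtain ⟨i, hi⟩ : ∃ i, x i + q * d i ≠ 0 := by
    by_contra! h
    refine hτ.ne (hq ▸ Eq.symm (Finset.sum_eq_zero fun i _ => ?_))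
    change w i * |x i + q * d i| = 0
    rw [h, abs_zero, mul_zero]
  have hev : ∀ᶠ z in 𝓝[≠] q, x i + z * d i ≠ 0 :=
    nhdsWithin_le_nhds ((isOpen_ne_fun (by fun_prop) continuous_const).mem_nhds hi)
  have hin : ∀ z : ℝ, weightedOneNorm w (x + z • d) ≤ τ →
      projectedLine w τ x d z i = x i + z * d i := fun z hz => by
    rw [projectedLine_of_threshold_eq_zero hw hτ x d ((threshold_eq_zero_iff hw hτ _).2 hz)]
    rfl
  refine hB.mem_of_frequently i (x i) (d i) (hin q hq.le)
    (h1.mono fun z hz => hin z (sub_pos.1 hz).le) ((h2.and_eventually hev).mono ?_)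
  -- Outside the ball the multiplier is positive, so the nonzero coordinate `i` is moved strictly.
  rintro z ⟨hz, hz'⟩
  have hpos : 0 < threshold w τ (x + z • d) := by
    refine lt_of_le_of_ne (threshold_spec hw hτ _).1 fun e => ?_
    have := (threshold_eq_zero_iff hw hτ _).1 e.symm
    linarith
  have hc := mul_pos hpos (hw i)
  rw [projectedLine_apply hw hτ]
  rcases lt_or_ge (threshold w τ (x + z • d) * w i) (x i + z * d i) with h | h
  · rw [softThreshold_of_lt hc.le h]
    linarith
  rcases lt_or_ge (threshold w τ (x + z • d) * w i) (-(x i + z * d i)) with h' | h'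
  · rw [softThreshold_of_lt_neg hc.le h']
    linarith
  · rw [softThreshold_of_abs_le (abs_le.2 ⟨by linarith, h⟩)]
    exact hz'.symm

/-- A single term of `softExcess` is at most `τ`; this makes the multiplier grow at least as fast as
any chosen coordinate. -/
theorem abs_le_threshold_add (v : EuclideanSpace ℝ (Fin n)) (i : Fin n) :
    w i * |v i| ≤ threshold w τ v * w i ^ 2 + τ := by
  have h := (threshold_spec hw hτ v).2.1
  have h' : w i * max (|v i| - threshold w τ v * w i) 0 ≤ softExcess w v (threshold w τ v) :=
    Finset.single_le_sum (f := fun i => w i * max (|v i| - threshold w τ v * w i) 0)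
      (fun j _ => mul_nonneg (hw j).le (le_max_right _ _)) (Finset.mem_univ i)
  have := mul_le_mul_of_nonneg_left (le_max_left (|v i| - threshold w τ v * w i) 0) (hw i).le
  linarith

end

/-! ### The extremal line and its breakpoints -/

/-- Weights for which the bound on the number of segments is attained. -/
noncomputable def extremalWeight (m : ℕ) (τ : ℝ) (k : Fin (m + 1)) : ℝ :=
  if k = 0 then √(3 * τ) else √(τ / (2 * m + 2) ^ 3)

/-- Direction of the line for which the bound on the number of segments is attained. -/
noncomputable def extremalDirection (m : ℕ) (τ : ℝ) : EuclideanSpace ℝ (Fin (m + 1)) :=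
  WithLp.toLp 2 fun k => extremalWeight m τ k * (2 * (k : ℕ) + 1)

/-- Base point of the line for which the bound on the number of segments is attained. -/
noncomputable def extremalPoint (m : ℕ) (τ : ℝ) : EuclideanSpace ℝ (Fin (m + 1)) :=
  WithLp.toLp 2 fun k => extremalWeight m τ k * (2 * (k : ℕ) + 1) * (k : ℕ)

section

variable (m : ℕ) {τ : ℝ} (hτ : 0 < τ)

theorem extremal_apply (τ α : ℝ) (k : Fin (m + 1)) :
    extremalPoint m τ k + α * extremalDirection m τ k =
      extremalWeight m τ k * ((2 * (k : ℕ) + 1) * (α + (k : ℕ))) := by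
  simp only [extremalPoint, extremalDirection]
  ring

include hτ

theorem extremalWeight_pos (k : Fin (m + 1)) : 0 < extremalWeight m τ k := by
  unfold extremalWeight
  split_ifs <;> positivity

theorem extremalWeight_zero_sq : extremalWeight m τ 0 ^ 2 = 3 * τ := by
  unfold extremalWeight
  rw [if_pos rfl, Real.sq_sqrt (by positivity)]

theorem extremalWeight_sq {k : Fin (m + 1)} (hk : k ≠ 0) :
    extremalWeight m τ k ^ 2 = τ / (2 * m + 2) ^ 3 := by
  unfold extremalWeight
  rw [if_neg hk, Real.sq_sqrt (by positivity)]

/-- At level `β` coordinate `0` is thresholded exactly to zero, and the light coordinates together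
contribute less than `τ`. This yields `λ (-β) < β`. -/
theorem softExcess_extremal_lt {β : ℝ} (h0 : 0 ≤ β) (hβ : β ≤ 2 * m + 1) :
    softExcess (extremalWeight m τ) (extremalPoint m τ + (-β) • extremalDirection m τ) β < τ := by
  have hterm : ∀ k ∈ (Finset.univ : Finset (Fin (m + 1))), extremalWeight m τ k *
      max (|(extremalPoint m τ + (-β) • extremalDirection m τ) k| - β * extremalWeight m τ k) 0 ≤
      τ / (2 * m + 2) ^ 3 * (2 * m + 1) ^ 2 := by
    intro k _
    have hw := extremalWeight_pos m hτ k
    have hv : |(extremalPoint m τ + (-β) • extremalDirection m τ) k| =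
        extremalWeight m τ k * ((2 * (k : ℕ) + 1) * |-β + (k : ℕ)|) := by
      change |extremalPoint m τ k + (-β) * extremalDirection m τ k| = _
      rw [extremal_apply, abs_mul, abs_mul, abs_of_pos hw,
        abs_of_pos (by positivity : (0 : ℝ) < 2 * (k : ℕ) + 1)]
    rw [hv]
    by_cases hk : k = 0
    · subst hk
      rw [max_eq_right, mul_zero]
      · positivity
      · simp only [Fin.val_zero, Nat.cast_zero, mul_zero, zero_add, one_mul, add_zero, abs_neg,
          abs_of_nonneg h0]
        linarith
    · rw [← extremalWeight_sq m hτ hk, sq (extremalWeight m τ k), mul_assoc]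
      refine mul_le_mul_of_nonneg_left (max_le ?_ (by positivity)) hw.le
      have hkm : ((k : ℕ) : ℝ) ≤ m := by exact_mod_cast Nat.lt_succ_iff.1 k.2
      have hk0 : (0 : ℝ) ≤ (k : ℕ) := Nat.cast_nonneg _
      have h1 : |-β + (k : ℕ)| ≤ 2 * m + 1 := abs_le.2 ⟨by linarith, by linarith⟩
      have h2 : (2 * (k : ℕ) + 1) * |-β + (k : ℕ)| ≤ ((2 * m + 1) ^ 2 : ℝ) := by
        rw [sq]
        exact mul_le_mul (by linarith) h1 (abs_nonneg _) (by positivity)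
      have := mul_le_mul_of_nonneg_left h2 hw.le
      have := mul_nonneg h0 hw.le
      linarith
  refine (Finset.sum_le_sum hterm).trans_lt ?_
  rw [Finset.sum_const, Finset.card_univ, Fintype.card_fin, nsmul_eq_mul]
  have hm : (0 : ℝ) ≤ m := Nat.cast_nonneg m
  have : ((m + 1 : ℕ) : ℝ) * (2 * m + 1) ^ 2 < (2 * m + 2) ^ 3 := by
    push_cast
    nlinarith [mul_nonneg hm hm, mul_nonneg hm (mul_nonneg hm hm)]
  calc ((m + 1 : ℕ) : ℝ) * (τ / (2 * m + 2) ^ 3 * (2 * m + 1) ^ 2)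
      = τ * (((m + 1 : ℕ) : ℝ) * (2 * m + 1) ^ 2 / (2 * m + 2) ^ 3) := by ring
    _ < τ * 1 := mul_lt_mul_of_pos_left ((div_lt_one (by positivity)).2 this) hτ
    _ = τ := mul_one τ

theorem weightedOneNorm_extremal_zero_lt : weightedOneNorm (extremalWeight m τ)
    (extremalPoint m τ + (0 : ℝ) • extremalDirection m τ) < τ := by
  have := softExcess_extremal_lt m hτ le_rfl (by positivity)
  rwa [softExcess_zero, neg_zero] at this

/-- Coordinate `0` alone contributes `3 τ |α|`. -/
theorem lt_weightedOneNorm_extremal {α : ℝ} (hα : 1 / 2 ≤ |α|) : τ < weightedOneNorm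
    (extremalWeight m τ) (extremalPoint m τ + α • extremalDirection m τ) := by
  have h : extremalWeight m τ 0 * |extremalPoint m τ 0 + α * extremalDirection m τ 0| ≤
      weightedOneNorm (extremalWeight m τ) (extremalPoint m τ + α • extremalDirection m τ) :=
    Finset.single_le_sum (f := fun i => extremalWeight m τ i *
      |(extremalPoint m τ + α • extremalDirection m τ) i|)
      (fun j _ => mul_nonneg (extremalWeight_pos m hτ j).le (abs_nonneg _)) (Finset.mem_univ 0)
  rw [extremal_apply, abs_mul, abs_of_pos (extremalWeight_pos m hτ 0), ← mul_assoc, ← sq,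
    extremalWeight_zero_sq m hτ] at h
  simp only [Fin.val_zero, Nat.cast_zero, mul_zero, zero_add, one_mul, add_zero] at h
  nlinarith

theorem card_le_of_isSegmentation_extremal {B : Finset ℝ} (hB : IsSegmentation
    (projectedLine (extremalWeight m τ) τ (extremalPoint m τ) (extremalDirection m τ)) B) :
    4 * m + 2 ≤ B.card := by
  have hw := extremalWeight_pos m hτ
  set w := extremalWeight m τ
  set x := extremalPoint m τ
  set d := extremalDirection m τ
  set lam : ℝ → ℝ := fun α => threshold w τ (x + α • d) with hlam
  have hm : (0 : ℝ) ≤ m := Nat.cast_nonneg m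
  have hlam_pos : ∀ α : ℝ, 1 / 2 ≤ |α| → 0 < lam α := fun α hα => by
    refine lt_of_le_of_ne (threshold_spec hw hτ _).1 fun e => ?_
    have := (threshold_eq_zero_iff hw hτ _).1 e.symm
    linarith [lt_weightedOneNorm_extremal m hτ hα]
  have hlam_lt : ∀ β : ℝ, 0 < β → β ≤ 2 * m + 1 → lam (-β) < β := fun β h0 hβ =>
    threshold_lt hw hτ _ h0 (softExcess_extremal_lt m hτ h0.le hβ)
  -- `H` is the slack divided by the weight, so that all coordinates are compared with the same
  -- function `lam`.
  set H : ℝ → Fin (m + 1) → ℝ → ℝ := fun s k α =>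
    s * ((2 * (k : ℕ) + 1) * (α + (k : ℕ))) - lam α with hH
  have hslack : ∀ s k α, s * (x k + α * d k) - lam α * w k = w k * H s k α := fun s k α => by
    rw [extremal_apply]
    simp only [hH]
    ring
  have hHc : ∀ s k, Continuous (H s k) := fun s k => by
    have := continuous_threshold hw hτ x d
    fun_prop
  have hmem : ∀ s k y q, (s = 1 ∨ s = -1) → 0 < H s k y → H s k q = 0 → 0 < lam q → q ∈ B := by
    intro s k y q hs hy hq hpos
    refine mem_of_slack_eq_zero hw hτ x d hB hs k (y := y) ?_ ?_ hpos
    · change 0 < s * (x k + y * d k) - lam y * w k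
      rw [hslack]
      exact mul_pos (hw k) hy
    · change s * (x k + q * d k) - lam q * w k = 0
      rw [hslack, hq, mul_zero]
  set C := τ / w (Fin.last m) ^ 2 with hC
  have hC0 : 0 < C := div_pos hτ (pow_pos (hw _) 2)
  -- The steepest coordinate bounds `lam` from below with slope `2 m + 1`, more than the slope `2 k
  -- + 1` of any `k < m`.
  have hfar : ∀ α : ℝ, (2 * m + 1) * |α + m| ≤ lam α + C := fun α => by
    have h := abs_le_threshold_add hw hτ (x + α • d) (Fin.last m)
    change w (Fin.last m) * |x (Fin.last m) + α * d (Fin.last m)| ≤ lam α * _ + τ at h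
    have hp := pow_pos (hw (Fin.last m)) 2
    rw [extremal_apply, abs_mul, abs_of_pos (hw _), abs_mul, Fin.val_last,
      abs_of_pos (by positivity : (0 : ℝ) < 2 * m + 1), ← mul_assoc, ← sq] at h
    rw [hC, ← sub_le_iff_le_add', le_div_iff₀ hp]
    linarith
  obtain ⟨a, ha1, ha2, ha⟩ := exists_root_left (continuous_sub_weightedOneNorm x d w τ)
    (by norm_num : -(1 / 2 : ℝ) ≤ 0)
    (sub_neg.2 (lt_weightedOneNorm_extremal m hτ (by rw [abs_neg]; exact le_abs_self _)))
    (sub_pos.2 (weightedOneNorm_extremal_zero_lt m hτ))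
  obtain ⟨b, hb1, hb2, hb⟩ := exists_root_right (continuous_sub_weightedOneNorm x d w τ)
    (by norm_num : (0 : ℝ) ≤ 1 / 2) (sub_pos.2 (weightedOneNorm_extremal_zero_lt m hτ))
    (sub_neg.2 (lt_weightedOneNorm_extremal m hτ (le_abs_self _)))
  have haB : a ∈ B := mem_of_weightedOneNorm_eq hw hτ x d hB
    (weightedOneNorm_extremal_zero_lt m hτ) (sub_eq_zero.1 ha).symm
  have hbB : b ∈ B := mem_of_weightedOneNorm_eq hw hτ x d hB
    (weightedOneNorm_extremal_zero_lt m hτ) (sub_eq_zero.1 hb).symm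
  have hlamb : lam b = 0 := (threshold_eq_zero_iff hw hτ _).2 (sub_eq_zero.1 hb).symm.le
  have hk0 : ∀ k : Fin m, (0 : ℝ) ≤ (k : ℕ) := fun k => Nat.cast_nonneg _
  have hkm : ∀ k : Fin m, ((k : ℕ) : ℝ) + 1 ≤ m := fun k => by exact_mod_cast k.2
  -- Coordinate `k + 1` leaves the support with positive sign.
  have h2 : ∀ k : Fin m, ∃ q, -((k : ℕ) + 1 : ℝ) < q ∧ q < -((k : ℕ) + 1 / 2 : ℝ) ∧ q ∈ B := by
    intro k
    have e1 : H 1 k.succ (-((k : ℕ) + 1 : ℝ)) < 0 := by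
      have := hlam_pos (-((k : ℕ) + 1 : ℝ)) (by
        rw [abs_neg]; exact le_trans (by linarith [hk0 k]) (le_abs_self _))
      simp only [hH, Fin.val_succ, Nat.cast_add, Nat.cast_one]
      ring_nf at this ⊢
      linarith
    have e2 : 0 < H 1 k.succ (-((k : ℕ) + 1 / 2 : ℝ)) := by
      have := hlam_lt ((k : ℕ) + 1 / 2 : ℝ) (by linarith [hk0 k]) (by linarith [hkm k])
      simp only [hH, Fin.val_succ, Nat.cast_add, Nat.cast_one]
      ring_nf at this ⊢
      linarith
    obtain ⟨q, hq1, hq2, hq⟩ := exists_root_left (hHc 1 k.succ) (by linarith) e1 e2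
    exact ⟨q, hq1, hq2, hmem 1 _ _ q (Or.inl rfl) e2 hq
      (hlam_pos q (le_abs.2 (Or.inr (by linarith [hk0 k]))))⟩
  -- Coordinate `k + 1` enters the support with negative sign.
  have h3 : ∀ k : Fin m, ∃ q, -((k : ℕ) + 3 / 2 : ℝ) < q ∧ q < -((k : ℕ) + 1 : ℝ) ∧ q ∈ B := by
    intro k
    have e1 : H (-1) k.succ (-((k : ℕ) + 1 : ℝ)) < 0 := by
      have := hlam_pos (-((k : ℕ) + 1 : ℝ)) (by
        rw [abs_neg]; exact le_trans (by linarith [hk0 k]) (le_abs_self _))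
      simp only [hH, Fin.val_succ, Nat.cast_add, Nat.cast_one]
      ring_nf at this ⊢
      linarith
    have e2 : 0 < H (-1) k.succ (-((k : ℕ) + 3 / 2 : ℝ)) := by
      have := hlam_lt ((k : ℕ) + 3 / 2 : ℝ) (by linarith [hk0 k]) (by linarith [hkm k])
      simp only [hH, Fin.val_succ, Nat.cast_add, Nat.cast_one]
      ring_nf at this ⊢
      linarith
    obtain ⟨q, hq1, hq2, hq⟩ := exists_root_right (hHc (-1) k.succ) (by linarith) e2 e1
    exact ⟨q, hq1, hq2, hmem (-1) _ _ q (Or.inr rfl) e2 hq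
      (hlam_pos q (le_abs.2 (Or.inr (by linarith [hk0 k]))))⟩
  -- Coordinate `k < m` leaves the support with negative sign.
  have h1 : ∀ k : Fin m, ∃ q, q < -(2 * m + 1 : ℝ) ∧ H (-1) k.castSucc q = 0 ∧ q ∈ B := by
    intro k
    -- Far enough out that the slope gap, at least `2`, outweighs the offset `(2 m + 1) m + C`.
    set β : ℝ := 2 * m + 1 + (2 * m + 1) * m + C with hβ
    have hβ0 : 2 * m + 1 ≤ β := by nlinarith
    have e1 : H (-1) k.castSucc (-β) < 0 := by
      have := hfar (-β)
      rw [abs_of_nonpos (by linarith)] at this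
      simp only [hH, Fin.val_castSucc]
      nlinarith [hk0 k, hkm k, mul_nonneg (hk0 k) (hk0 k),
        mul_nonneg (sub_nonneg.2 (hkm k)) (by linarith : 0 ≤ β)]
    have e2 : 0 < H (-1) k.castSucc (-(2 * m + 1)) := by
      have := hlam_lt (2 * m + 1) (by linarith) le_rfl
      simp only [hH, Fin.val_castSucc]
      nlinarith [hk0 k, hkm k, mul_nonneg (hk0 k) (sub_nonneg.2 (hkm k))]
    obtain ⟨q, hq1, hq2, hq⟩ := exists_root_left (hHc (-1) k.castSucc) (by linarith) e1 e2
    exact ⟨q, hq2, hq, hmem (-1) _ _ q (Or.inr rfl) e2 hq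
      (hlam_pos q (le_abs.2 (Or.inr (by linarith))))⟩
  -- Coordinate `k < m` leaves the support with positive sign, after the line has left the ball.
  have h4 : ∀ k : Fin m, ∃ q, b < q ∧ H 1 k.castSucc q = 0 ∧ q ∈ B := by
    intro k
    have e1 : 0 < H 1 k.castSucc b := by
      simp only [hH, Fin.val_castSucc, hlamb]
      have := mul_pos (by linarith [hk0 k] : (0 : ℝ) < 2 * (k : ℕ) + 1)
        (by linarith [hk0 k] : 0 < b + (k : ℕ))
      linarith
    have e2 : H 1 k.castSucc (b + C) < 0 := by
      have := hfar (b + C)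
      rw [abs_of_pos (by linarith)] at this
      simp only [hH, Fin.val_castSucc]
      nlinarith [hk0 k, hkm k, mul_nonneg (sub_nonneg.2 (hkm k)) (by linarith : 0 ≤ b + C),
        mul_nonneg (sub_nonneg.2 (hkm k)) (hk0 k)]
    obtain ⟨q, hq1, hq2, hq⟩ := exists_root_right (hHc 1 k.castSucc) (by linarith) e1 e2
    refine ⟨q, hq1, hq, hmem 1 _ _ q (Or.inl rfl) e1 hq ?_⟩
    have := mul_pos (by linarith [hk0 k] : (0 : ℝ) < 2 * (k : ℕ) + 1)
        (by linarith [hk0 k] : 0 < q + (k : ℕ))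
    simp only [hH, Fin.val_castSucc] at hq
    linarith
  choose E1 h1a h1b h1B using h1
  choose E2 h2a h2b h2B using h2
  choose E3 h3a h3b h3B using h3
  choose E4 h4a h4b h4B using h4
  have i1 : Function.Injective E1 := by
    intro k j e
    by_contra hkj
    have hk := h1b k
    have hj := h1b j
    rw [← e] at hj
    simp only [hH, Fin.val_castSucc] at hk hj
    -- A common root equates `(2 k + 1) (-q - k)` with the same expression in `j`; for `k ≠ j` this
    -- forces `-2 q = 2 (k + j) + 1`, impossible when `q < -(2 m + 1)`.
    have hfac : (((k : ℕ) : ℝ) - (j : ℕ)) * (2 * (-E1 k) - 2 * ((k : ℕ) + (j : ℕ)) - 1) = 0 := by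
      linear_combination hk - hj
    rcases mul_eq_zero.1 hfac with h | h
    · exact hkj (Fin.ext (by exact_mod_cast sub_eq_zero.1 h))
    · linarith [h1a k, hkm k, hkm j]
  have i4 : Function.Injective E4 := by
    intro k j e
    by_contra hkj
    have hk := h4b k
    have hj := h4b j
    rw [← e] at hj
    simp only [hH, Fin.val_castSucc] at hk hj
    have hfac : (((k : ℕ) : ℝ) - (j : ℕ)) * (2 * E4 k + 2 * ((k : ℕ) + (j : ℕ)) + 1) = 0 := by
      linear_combination hk - hj
    rcases mul_eq_zero.1 hfac with h | h
    · exact hkj (Fin.ext (by exact_mod_cast sub_eq_zero.1 h))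
    · linarith [h4a k, hk0 k, hk0 j]
  have hcast : ∀ {k j : ℕ}, (k : ℝ) < j + 1 → (k : ℕ) ≤ j := fun h => by
    rw [← Nat.lt_succ_iff]
    exact_mod_cast h
  have i2 : Function.Injective E2 := fun k j e => Fin.ext <| le_antisymm
    (hcast (by linarith [h2a k, h2b k, h2a j, h2b j]))
    (hcast (by linarith [h2a k, h2b k, h2a j, h2b j]))
  have i3 : Function.Injective E3 := fun k j e => Fin.ext <| le_antisymm
    (hcast (by linarith [h3a k, h3b k, h3a j, h3b j]))
    (hcast (by linarith [h3a k, h3b k, h3a j, h3b j]))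
  have i23 : ∀ k j, E2 k ≠ E3 j := fun k j e => by
    have h1 : (j : ℕ) + 1 ≤ (k : ℕ) := by
      have : ((j : ℕ) : ℝ) < (k : ℕ) := by linarith [h2a k, h3b j]
      exact_mod_cast this
    have h2 : ((j : ℕ) : ℝ) + 1 ≤ (k : ℕ) := by exact_mod_cast h1
    linarith [h2b k, h3a j]
  have i5 : Function.Injective fun c : Bool => if c then a else b := by
    intro c c' e
    cases c <;> cases c' <;> simp at e ⊢ <;> linarith
  have i45 : Function.Injective (Sum.elim E4 fun c : Bool => if c then a else b) := by
    refine i4.sumElim i5 fun k c => ?_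
    cases c <;> simp <;> linarith [h4a k]
  have hright : ∀ r, -(1 / 2) < (Sum.elim E4 fun c : Bool => if c then a else b) r := by
    rintro (k | c)
    · simp only [Sum.elim_inl]
      linarith [h4a k]
    · cases c <;> simp <;> linarith
  have i23' : Function.Injective (Sum.elim E2 E3) := i2.sumElim i3 i23
  have hmid : ∀ r, -(2 * m + 1 : ℝ) < Sum.elim E2 E3 r ∧ Sum.elim E2 E3 r < -(1 / 2) := by
    rintro (k | k)
    · simp only [Sum.elim_inl]
      constructor <;> linarith [h2a k, h2b k, hk0 k, hkm k]
    · simp only [Sum.elim_inr]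
      constructor <;> linarith [h3a k, h3b k, hk0 k, hkm k]
  -- The families are separated by location: `E1` below `-(2 m + 1)`, `E2` and `E3` between there
  -- and `-1/2`, the ball endpoints and `E4` above `-1/2`. In number, `4 m + 2`.
  have i : Function.Injective (Sum.elim E1 (Sum.elim (Sum.elim E2 E3)
      (Sum.elim E4 fun c : Bool => if c then a else b))) := by
    refine i1.sumElim (i23'.sumElim i45 fun r r' => ?_) ?_
    · exact ((hmid r).2.trans (hright r')).ne
    · rintro k (r | r)
      · exact ((h1a k).trans (hmid r).1).ne
      · exact ((h1a k).trans (lt_of_le_of_lt (by linarith) (hright r))).ne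
  have hsub : Finset.univ.image (Sum.elim E1 (Sum.elim (Sum.elim E2 E3)
      (Sum.elim E4 fun c : Bool => if c then a else b))) ⊆ B := by
    intro z hz
    obtain ⟨r, -, rfl⟩ := Finset.mem_image.1 hz
    rcases r with k | (k | k) | k | c
    exacts [h1B k, h2B k, h3B k, h4B k, by cases c <;> simp [haB, hbB]]
  have hcard := Finset.card_le_card hsub
  rw [Finset.card_image_of_injective _ i, Finset.card_univ] at hcard
  simp only [Fintype.card_sum, Fintype.card_fin, Fintype.card_bool] at hcard
  omega

end

theorem mainTheorem3 (n : ℕ) (hn : 1 ≤ n) (τ : ℝ) (hτ : 0 < τ) :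
    (∀ w : Fin n → ℝ, (∀ i, 0 < w i) → ∀ x d : EuclideanSpace ℝ (Fin n),
      IsPiecewiseLinear (projectedLine w τ x d) ∧
        numSegments (projectedLine w τ x d) ≤ 4 * n - 1) ∧
    (∃ w : Fin n → ℝ, (∀ i, 0 < w i) ∧ ∃ x d : EuclideanSpace ℝ (Fin n),
      IsPiecewiseLinear (projectedLine w τ x d) ∧
        numSegments (projectedLine w τ x d) = 4 * n - 1) := by
  have upper : ∀ w : Fin n → ℝ, (∀ i, 0 < w i) → ∀ x d : EuclideanSpace ℝ (Fin n),
      IsPiecewiseLinear (projectedLine w τ x d) ∧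
        numSegments (projectedLine w τ x d) ≤ 4 * n - 1 := by
    intro w hw x d
    obtain ⟨B, hB, hcard⟩ := exists_isSegmentation_projectedLine hw hτ x d hn
    have : numSegments (projectedLine w τ x d) ≤ B.card + 1 := Nat.sInf_le ⟨B, hB, rfl⟩
    exact ⟨⟨B, hB⟩, by omega⟩
  refine ⟨upper, ?_⟩
  obtain ⟨m, rfl⟩ : ∃ m, n = m + 1 := ⟨n - 1, by omega⟩
  obtain ⟨⟨B, hB⟩, hle⟩ := upper _ (extremalWeight_pos m hτ) (extremalPoint m τ)
    (extremalDirection m τ)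
  refine ⟨_, extremalWeight_pos m hτ, _, _, ⟨B, hB⟩, le_antisymm hle (le_csInf ⟨_, B, hB, rfl⟩ ?_)⟩
  rintro _ ⟨B', hB', rfl⟩
  have := card_le_of_isSegmentation_extremal m hτ hB'
  omega
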